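/- Let $K$ be a field and let $I\subsetneq J$ be squarefree monomial ideals of $S=K[x_1,\ldots,x_4]$ (ideals generated by squarefree monomials; $J=S$ is allowed) with $I\neq 0$. Suppose that $\dim S/Q=3$ for every associated prime $Q$ of the $S$-module $J/I$. Then $\operatorname{sdepth}_S J/I\ \geq\ \operatorname{depth}_S J/I$. Here $\operatorname{depth}_S J/I$ is the largest length of a $J/I$-regular sequence in $(x_1,\ldots,x_4)$. A Stanley decomposition of the $\mathbb{Z}^4$-graded module $J/I$ is a presentation of the $K$-vector space $J/I$ as a finite direct sum $\bigoplus_{i=1}^r m_iK[Z_i]$, where each $m_i\in J/I$ is nonzero and homogeneous for the $\mathbb{Z}^4$-grading, $Z_i\subseteq\{x_1,\ldots,x_4\}$, and $m_iK[Z_i]=\{m_if: f\in K[Z_i]\}$ is a free $K[Z_i]$-module. The Stanley depth $\operatorname{sdepth}_S J/I$ is the maximum of $\min_i |Z_i|$ over all Stanley decompositions of $J/I$. -/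

import Mathlib

noncomputable section

namespace StanleyDepth

open MvPolynomial

/-- The squarefree monomial `∏_{i ∈ s} x_i` of `K[x_i : i ∈ σ]`. -/
def sqfreeMonomial {σ : Type*} (K : Type*) [Field K] (s : Finset σ) : MvPolynomial σ K :=
  ∏ i ∈ s, X i

/-- A squarefree monomial ideal: an ideal generated by squarefree monomials. The zero ideal and the
unit ideal are included. -/
def IsSqfreeMonomialIdeal {σ K : Type*} [Field K] (I : Ideal (MvPolynomial σ K)) : Prop :=
  ∃ A : Set (Finset σ), I = Ideal.span (sqfreeMonomial K '' A)

/-- The `S`-module `J / I` for ideals `I ⊆ J` of `S` (in general it is `J / (I ∩ J)`). -/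
abbrev IdealQuotient {S : Type*} [CommRing S] (I J : Ideal S) : Type _ :=
  J ⧸ Submodule.submoduleOf I J

/-- The `K`-subspace `K x^a` of `K[x_i : i ∈ σ]` for `a : σ → ℤ`; it is zero if `a` has a negative
entry. -/
def polyPiece {σ : Type*} (K : Type*) [Field K] (a : σ → ℤ) :
    Submodule K (MvPolynomial σ K) :=
  restrictSupport K {d : σ →₀ ℕ | ∀ i, (d i : ℤ) = a i}

/-- The component of degree `a` in the multigrading of `J / I`: the classes of the elements of
`J ∩ K x^a`. -/
def quotientPiece {σ K : Type*} [Field K] (I J : Ideal (MvPolynomial σ K)) (a : σ → ℤ) :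
    Submodule K (IdealQuotient I J) :=
  ((polyPiece K a).comap ((Submodule.subtype J).restrictScalars K)).map
    ((Submodule.mkQ (Submodule.submoduleOf I J)).restrictScalars K)

section

variable {σ K M : Type*} [Field K] [AddCommGroup M] [Module (MvPolynomial σ K) M]

/-- The set `m K[Z]` of all `f • m`, `f ∈ K[Z]`, as a `K[Z]`-submodule of `M`. Here
`K[Z]` is the subalgebra of the polynomials in the variables from `Z`. -/
def polySpan (m : M) (Z : Finset σ) : Submodule (supported K (Z : Set σ)) M :=
  Submodule.span (supported K (Z : Set σ)) {m}

/-- For `m ≠ 0`, the `K[Z]`-module `m K[Z]` is free if and only if no nonzero element of `K[Z]`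
annihilates `m`. -/
theorem polySpan_free_iff (m : M) (Z : Finset σ) (hm : m ≠ 0) :
    Module.Free (supported K (Z : Set σ)) (polySpan (K := K) m Z) ↔
      ∀ f ∈ supported K (Z : Set σ), f • m = 0 → f = 0 := by
  constructor
  · intro h f hf h0
    have ht : Module.IsTorsionFree (supported K (Z : Set σ)) (polySpan (K := K) m Z) :=
      (Module.Free.chooseBasis (supported K (Z : Set σ)) (polySpan (K := K) m Z)).isTorsionFree
    let v : polySpan (K := K) m Z := ⟨m, Submodule.mem_span_singleton_self m⟩
    have hv : v ≠ 0 := fun h => hm (congrArg Subtype.val h)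
    by_contra hf0
    have hg : (⟨f, hf⟩ : supported K (Z : Set σ)) ≠ 0 := fun h => hf0 (congrArg Subtype.val h)
    have := ht.isSMulRegular (IsRegular.of_ne_zero hg) (a₁ := v) (a₂ := 0)
      (Subtype.ext (h0.trans (smul_zero _).symm))
    exact hv this
  · intro h
    let φ := LinearMap.toSpanSingleton (supported K (Z : Set σ)) M m
    have hi : Function.Injective φ := by
      rw [← LinearMap.ker_eq_bot, LinearMap.ker_eq_bot']
      intro f hf; exact Subtype.ext (h f.1 f.2 hf)
    have e := LinearEquiv.ofInjective φ hi
    have : LinearMap.range φ = polySpan (K := K) m Z := LinearMap.range_toSpanSingleton _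
    rw [this] at e
    exact Module.Free.of_equiv e

variable [Module K M] [IsScalarTower K (MvPolynomial σ K) M]

/-- A Stanley decomposition of a multigraded `K[x_i : i ∈ σ]`-module `M`, whose component of degree
`a` is `𝓜 a`: a presentation of `M`, as a `K`-vector space, as a finite direct sum of subspaces
`m_i K[Z_i]`, where `m_i` is a (nonzero) homogeneous element and `m_i K[Z_i]` is a free
`K[Z_i]`-module. -/
structure StanleyDecomposition (𝓜 : (σ → ℤ) → Submodule K M) where
  /-- the number of summands -/
  r : ℕ
  /-- the generators -/
  m : Fin r → M
  /-- the sets of variables -/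
  Z : Fin r → Finset σ
  homogeneous : ∀ i, SetLike.IsHomogeneousElem 𝓜 (m i)
  ne_zero : ∀ i, m i ≠ 0
  free : ∀ i, Module.Free (supported K (Z i : Set σ)) (polySpan (K := K) (m i) (Z i))
  isInternal : DirectSum.IsInternal
    fun i => (polySpan (K := K) (m i) (Z i)).restrictScalars K

/-- The Stanley depth of a decomposition: the least `|Z_i|`. -/
def StanleyDecomposition.sdepth {𝓜 : (σ → ℤ) → Submodule K M} (D : StanleyDecomposition 𝓜) : ℕ∞ :=
  ⨅ i, ((D.Z i).card : ℕ∞)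

/-- The Stanley depth of a multigraded module: the largest Stanley depth of a Stanley
decomposition. -/
def sdepth (𝓜 : (σ → ℤ) → Submodule K M) : ℕ∞ :=
  ⨆ D : StanleyDecomposition 𝓜, D.sdepth

end

/-- The depth of a `K[x_i : i ∈ σ]`-module `M`: the largest length of an `M`-regular sequence in the
graded maximal ideal `(x_i : i ∈ σ)`. -/
def depth (σ K : Type*) [Field K] (M : Type*) [AddCommGroup M]
    [Module (MvPolynomial σ K) M] : ℕ∞ :=
  ⨆ (rs : List (MvPolynomial σ K))
    (_ : (∀ f ∈ rs, f ∈ idealOfVars σ K) ∧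
      RingTheory.Sequence.IsRegular M rs), (rs.length : ℕ∞)

end StanleyDepth

end

/-! An associated prime of `J / I` contains `I`, hence some variable `x_i`; since its quotient has
dimension 3, it equals `(x_i)`. Let `T` be the set of these `i` and `U = (x_T)`. As `I` is radical,
`I = J ∩ U`, so `J / I ≅ J' / U` with `J' = J + U`. Let `F` be the family of sets `B` with `x_B ∈
J'`: the nonfaces of a simplicial complex `Δ` on four vertices. Partitioning the members of `F` not
containing `T` into intervals `[A, B]` gives a Stanley decomposition with summands `x_A K[B]`, so it
suffices to make every `|B|` at least the depth.

The depth is at most 3 because `I ≠ 0`. The sequence `0 → J'/U → S/U → S/J' → 0` turns depth into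
properties of `Δ`. If `J' = S`, depth 3 is always matched. Otherwise `∅ ∉ F`, which settles depth at
most 1; depth 2 gives `(J' : (x_i)) = J'`, so `Δ` has a vertex; depth 3 kills the first Koszul
cohomology of `S/J'`, so `Δ` is connected and not a point.

For depth 2 each singleton is paired with a two-element set (`isPartitionable_two`). For depth 3 the
intervals are `[A_k, {k}ᶜ]`, `k ∈ T`, for a suitable order on `T` (`isPartitionable_of_order`),
whose existence is a finite check on the graph of `Δ` (`hasGoodOrder`). -/

noncomputable section

namespace StanleyDepth

open MvPolynomial

/-! ### Regular sequences and Koszul cohomology in low degree -/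

section Regular

open RingTheory.Sequence Module

variable {R M : Type*} [CommRing R] [AddCommGroup M] [Module R M]

/-- The length of a regular sequence on a finite module is at most the dimension of its support. -/
theorem length_le_supportDim [IsNoetherianRing R] (rs : List R) :
    ∀ (M : Type _) [AddCommGroup M] [Module R M] [Module.Finite R M],
      IsRegular M rs → (rs.length : WithBot ℕ∞) ≤ supportDim R M := by
  induction rs with
  | nil =>
    intro M _ _ _ h
    have : Nontrivial M := h.nontrivial
    have h0 := (supportDim_ne_bot_iff_nontrivial R M).mpr this
    obtain ⟨a, ha⟩ := WithBot.ne_bot_iff_exists.mp h0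
    rw [← ha]
    exact_mod_cast zero_le (a := a)
  | cons r rs ih =>
    intro M _ _ _ h
    rw [isRegular_cons_iff] at h
    have h1 := ih (QuotSMulTop r M) h.2
    have h2 := supportDim_quotSMulTop_succ_le_of_notMem_minimalPrimes (R := R) (M := M) (x := r)
      fun p hp => h.1.notMem_of_mem_minimalPrimes hp
    refine le_trans ?_ h2
    rw [List.length_cons, Nat.cast_add, Nat.cast_one]
    gcongr

theorem quotSMulTop_mk_eq_zero_iff (r : R) (x : M) :
    (Submodule.Quotient.mk x : QuotSMulTop r M) = 0 ↔ ∃ y : M, r • y = x := by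
  rw [Submodule.Quotient.mk_eq_zero, Submodule.mem_smul_pointwise_iff_exists]
  simp

/-- The class of `x` in `M / fM` is killed by `g`, which is regular there. -/
theorem IsRegular.second {f g : R} {rs : List R} (h : IsRegular M (f :: g :: rs)) {x y : M}
    (hxy : g • x = f • y) : ∃ z, f • z = x := by
  rw [isRegular_cons_iff, isRegular_cons_iff] at h
  rw [← quotSMulTop_mk_eq_zero_iff]
  refine (isSMulRegular_iff_right_eq_zero_of_smul.mp h.2.1) _ ?_
  rw [← Submodule.Quotient.mk_smul, quotSMulTop_mk_eq_zero_iff]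
  exact ⟨y, hxy.symm⟩

/-- This is `IsRegular.second` for `g, k` on `M / fM`. -/
theorem IsRegular.third {f g k : R} {rs : List R} (h : IsRegular M (f :: g :: k :: rs))
    {x y z : M} (hxy : k • x = f • y + g • z) : ∃ y' z', x = f • y' + g • z' := by
  rw [isRegular_cons_iff] at h
  obtain ⟨w, hw⟩ := IsRegular.second h.2 (x := Submodule.Quotient.mk x)
    (y := Submodule.Quotient.mk z) (by
      rw [← Submodule.Quotient.mk_smul, ← Submodule.Quotient.mk_smul, ← sub_eq_zero,
        ← Submodule.Quotient.mk_sub, quotSMulTop_mk_eq_zero_iff]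
      exact ⟨y, by rw [hxy]; abel⟩)
  obtain ⟨w, rfl⟩ := Submodule.Quotient.mk_surjective _ w
  rw [← Submodule.Quotient.mk_smul, eq_comm, ← sub_eq_zero, ← Submodule.Quotient.mk_sub,
    quotSMulTop_mk_eq_zero_iff] at hw
  obtain ⟨y', hy'⟩ := hw
  exact ⟨y', w, by rw [hy']; abel⟩

variable {U J : Ideal R}

theorem idealQuotient_mk_eq_zero_iff (x : J) :
    (Submodule.Quotient.mk x : IdealQuotient U J) = 0 ↔ (x : R) ∈ U := by
  rw [Submodule.Quotient.mk_eq_zero]; rfl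

theorem idealQuotient_mk_eq_iff (x y : J) :
    (Submodule.Quotient.mk x : IdealQuotient U J) = Submodule.Quotient.mk y ↔
      (x : R) - y ∈ U := by
  rw [← sub_eq_zero, ← Submodule.Quotient.mk_sub, idealQuotient_mk_eq_zero_iff]; rfl

theorem mem_of_isRegular_first {f : R} {rs : List R}
    (h : IsRegular (IdealQuotient U J) (f :: rs)) {x : R} (hx : x ∈ J) (hfx : f * x ∈ U) :
    x ∈ U := by
  rw [isRegular_cons_iff] at h
  have := (isSMulRegular_iff_right_eq_zero_of_smul.mp h.1) (Submodule.Quotient.mk ⟨x, hx⟩) (by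
    rw [← Submodule.Quotient.mk_smul, idealQuotient_mk_eq_zero_iff]; exact hfx)
  exact (idealQuotient_mk_eq_zero_iff _).mp this

theorem exists_of_isRegular_second {f g : R} {rs : List R}
    (h : IsRegular (IdealQuotient U J) (f :: g :: rs)) {x y : R} (hx : x ∈ J) (hy : y ∈ J)
    (hxy : g * x - f * y ∈ U) : ∃ z ∈ J, x - f * z ∈ U := by
  obtain ⟨z, hz⟩ := IsRegular.second h (x := Submodule.Quotient.mk ⟨x, hx⟩)
    (y := Submodule.Quotient.mk ⟨y, hy⟩) (by
      rw [← Submodule.Quotient.mk_smul, ← Submodule.Quotient.mk_smul, idealQuotient_mk_eq_iff]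
      exact hxy)
  obtain ⟨z, rfl⟩ := Submodule.Quotient.mk_surjective _ z
  rw [← Submodule.Quotient.mk_smul, eq_comm, idealQuotient_mk_eq_iff] at hz
  exact ⟨z, z.2, hz⟩

theorem exists_of_isRegular_third {f g k : R} {rs : List R}
    (h : IsRegular (IdealQuotient U J) (f :: g :: k :: rs)) {x y z : R} (hx : x ∈ J) (hy : y ∈ J)
    (hz : z ∈ J) (hxy : k * x - (f * y + g * z) ∈ U) :
    ∃ p ∈ J, ∃ q ∈ J, x - (f * p + g * q) ∈ U := by
  obtain ⟨p, q, hpq⟩ := IsRegular.third h (x := Submodule.Quotient.mk ⟨x, hx⟩)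
    (y := Submodule.Quotient.mk ⟨y, hy⟩) (z := Submodule.Quotient.mk ⟨z, hz⟩) (by
      rw [← Submodule.Quotient.mk_smul, ← Submodule.Quotient.mk_smul,
        ← Submodule.Quotient.mk_smul, ← Submodule.Quotient.mk_add, idealQuotient_mk_eq_iff]
      exact hxy)
  obtain ⟨p, rfl⟩ := Submodule.Quotient.mk_surjective _ p
  obtain ⟨q, rfl⟩ := Submodule.Quotient.mk_surjective _ q
  rw [← Submodule.Quotient.mk_smul, ← Submodule.Quotient.mk_smul, ← Submodule.Quotient.mk_add,
    idealQuotient_mk_eq_iff] at hpq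
  exact ⟨p, p.2, q, q.2, hpq⟩

/-- An ideal `J ⊇ U` such that `J / U` has a regular sequence of length two in the ideal generated
by `X` contains `(J : X)`. -/
theorem mem_of_isRegular_pair (hU : U ≤ J) {X : Set R} {f g : R} {rs : List R}
    (h : IsRegular (IdealQuotient U J) (f :: g :: rs)) (hf : f ∈ Ideal.span X)
    (hg : g ∈ Ideal.span X) (hfU : ∀ z, f * z ∈ U → z ∈ U) {s : R} (hs : ∀ x ∈ X, x * s ∈ J) :
    s ∈ J := by
  have key : ∀ y ∈ Ideal.span X, y * s ∈ J := by
    have : Ideal.span X ≤ Submodule.colon J {s} := Ideal.span_le.mpr fun x hx => by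
      simpa [Submodule.mem_colon_singleton] using hs x hx
    intro y hy
    simpa [Submodule.mem_colon_singleton] using this hy
  -- The trivial relation `g (f s) = f (g s)` has both `f s` and `g s` in `J`, so `f s ≡ f z` modulo
  -- `U` with `z ∈ J`; then `f` cancels.
  obtain ⟨z, hz, hfz⟩ := exists_of_isRegular_second h (key f hf) (key g hg)
    (by convert U.zero_mem using 1; ring)
  have := hfU (s - z) (by rwa [mul_sub])
  simpa using J.add_mem (hU this) hz

/-- If `J / U` has a regular sequence of length three in `(x_i)`, and the first Koszul cohomology
of the `x_i` on `S / U` vanishes, then so does the first Koszul cohomology on `S / J`. -/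
theorem exists_coboundary_of_isRegular_triple {n : ℕ} (x : Fin n → R) {f g k : R} {rs : List R}
    (h : IsRegular (IdealQuotient U J) (f :: g :: k :: rs)) (hU : U ≤ J)
    (hf : f ∈ Ideal.span (Set.range x))
    (hg : g ∈ Ideal.span (Set.range x)) (hk : k ∈ Ideal.span (Set.range x))
    (hfU : ∀ z, f * z ∈ U → z ∈ U)
    (hcoh : ∀ a : Fin n → R, (∀ i j, x j * a i - x i * a j ∈ U) →
      ∃ c, ∀ i, a i - x i * c ∈ U)
    (a : Fin n → R) (ha : ∀ i j, x j * a i - x i * a j ∈ J) :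
    ∃ c, ∀ i, a i - x i * c ∈ J := by
  have pair : ∀ c d : Fin n → R, (∑ i, c i * x i) * (∑ i, d i * a i) -
      (∑ i, d i * x i) * (∑ i, c i * a i) ∈ J := by
    intro c d
    rw [mul_comm (∑ i, d i * x i), Finset.sum_mul_sum, Finset.sum_mul_sum,
      ← Finset.sum_sub_distrib]
    refine J.sum_mem fun i _ => ?_
    rw [← Finset.sum_sub_distrib]
    refine J.sum_mem fun j _ => ?_
    convert J.mul_mem_left (c i * d j) (ha j i) using 1
    ring
  rw [Ideal.mem_span_range_iff_exists_fun] at hf hg hk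
  obtain ⟨cf, rfl⟩ := hf
  obtain ⟨cg, rfl⟩ := hg
  obtain ⟨ck, rfl⟩ := hk
  have single : ∀ (c : Fin n → R) (i : Fin n),
      x i * (∑ j, c j * a j) - (∑ j, c j * x j) * a i ∈ J := by
    intro c i
    simpa [Pi.single_apply] using pair (Pi.single i 1) c
  have hfg := pair cf cg
  have hfk := pair cf ck
  have hkg := pair ck cg
  have hFi := single cf
  have hGi := single cg
  set f := ∑ i, cf i * x i
  set g := ∑ i, cg i * x i
  set k := ∑ i, ck i * x i
  set F := ∑ i, cf i * a i
  set G := ∑ i, cg i * a i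
  set K := ∑ i, ck i * a i
  -- The relation used is `k(fG - gF) = f(kG - gK) + g(fK - kF)`. It gives `f(G - p) ≡ g(F + q)`
  -- modulo `U`.
  obtain ⟨p, hp, q, hq, hpq⟩ := exists_of_isRegular_third h hfg hkg hfk
    (by convert U.zero_mem using 1; ring)
  have step : ∀ i, ∃ r ∈ J, x i * (F + q) - f * (a i + r) ∈ U := by
    intro i
    obtain ⟨r, hr, hr'⟩ := exists_of_isRegular_second h
      (x := x i * F - f * a i + x i * q) (y := x i * G - g * a i - x i * p)
      (J.add_mem (hFi i) (J.mul_mem_left _ hq)) (J.sub_mem (hGi i) (J.mul_mem_left _ hp)) (by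
        convert U.mul_mem_left (-x i) hpq using 1
        ring)
    exact ⟨r, hr, by convert hr' using 1; ring⟩
  choose r hr hr' using step
  -- Since `f (a i + r i) ≡ x i (F + q)` modulo `U`, the corrected family is a cocycle modulo `U`
  -- after cancelling `f`.
  obtain ⟨c, hc⟩ := hcoh (fun i => a i + r i) fun i j => hfU _ (by
    convert U.sub_mem (U.mul_mem_left (x i) (hr' j)) (U.mul_mem_left (x j) (hr' i)) using 1
    ring)
  refine ⟨c, fun i => ?_⟩
  convert J.sub_mem (hU (hc i)) (hr i) using 1
  ring

end Regular

/-! ### Squarefree monomial ideals and supports of exponents -/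

section Monomial

variable {σ K : Type*} [Field K]

/-- The exponent vector of the squarefree monomial `x_s`. -/
def sqfreeExponent (s : Finset σ) : σ →₀ ℕ := ∑ i ∈ s, Finsupp.single i 1

theorem sqfreeExponent_apply [DecidableEq σ] (s : Finset σ) (i : σ) :
    sqfreeExponent s i = if i ∈ s then 1 else 0 := by
  simp [sqfreeExponent, Finsupp.finsetSum_apply, Finsupp.single_apply]

theorem support_sqfreeExponent (s : Finset σ) : (sqfreeExponent s).support = s := by
  classical
  ext i
  simp [sqfreeExponent_apply]

theorem sqfreeExponent_le_iff {s : Finset σ} {d : σ →₀ ℕ} :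
    sqfreeExponent s ≤ d ↔ s ⊆ d.support := by
  classical
  simp only [Finsupp.le_def, sqfreeExponent_apply, Finset.subset_iff, Finsupp.mem_support_iff]
  refine forall_congr' fun i => ?_
  split_ifs with h <;> simp [h, Nat.one_le_iff_ne_zero]

theorem sqfreeMonomial_eq (s : Finset σ) :
    sqfreeMonomial K s = monomial (sqfreeExponent s) 1 := by
  rw [sqfreeMonomial, sqfreeExponent, monomial_sum_one]
  rfl

theorem mem_span_sqfreeMonomial_iff {A : Set (Finset σ)} {p : MvPolynomial σ K} :
    p ∈ Ideal.span (sqfreeMonomial K '' A) ↔ ∀ d ∈ p.support, ∃ s ∈ A, s ⊆ d.support := by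
  have : sqfreeMonomial K '' A = (fun d => monomial d (1 : K)) '' (sqfreeExponent '' A) := by
    rw [Set.image_image]
    exact Set.image_congr fun s _ => sqfreeMonomial_eq s
  rw [this, mem_ideal_span_monomial_image]
  simp [sqfreeExponent_le_iff]

theorem sqfreeMonomial_mem_span_iff {A : Set (Finset σ)} {B : Finset σ} :
    sqfreeMonomial K B ∈ Ideal.span (sqfreeMonomial K '' A) ↔ ∃ s ∈ A, s ⊆ B := by
  classical
  rw [mem_span_sqfreeMonomial_iff, sqfreeMonomial_eq, support_monomial]
  simp [support_sqfreeExponent]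

variable {I : Ideal (MvPolynomial σ K)}

/-- Only the supports of exponents matter, so such an ideal is encoded by an upward closed family of
sets. -/
theorem IsSqfreeMonomialIdeal.mem_iff (hI : IsSqfreeMonomialIdeal I) {p : MvPolynomial σ K} :
    p ∈ I ↔ ∀ d ∈ p.support, sqfreeMonomial K d.support ∈ I := by
  obtain ⟨A, rfl⟩ := hI
  simp only [mem_span_sqfreeMonomial_iff (p := p), sqfreeMonomial_mem_span_iff]

theorem IsSqfreeMonomialIdeal.monomial_mem_iff (hI : IsSqfreeMonomialIdeal I) {d : σ →₀ ℕ}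
    {c : K} (hc : c ≠ 0) : monomial d c ∈ I ↔ sqfreeMonomial K d.support ∈ I := by
  classical
  rw [hI.mem_iff, support_monomial]
  simp [hc]

theorem sqfreeMonomial_dvd {B C : Finset σ} (h : B ⊆ C) :
    sqfreeMonomial K B ∣ sqfreeMonomial K C := Finset.prod_dvd_prod_of_subset _ _ _ h

theorem sqfreeMonomial_mem_of_subset {B C : Finset σ} (h : B ⊆ C)
    (hB : sqfreeMonomial K B ∈ I) : sqfreeMonomial K C ∈ I :=
  I.mem_of_dvd (sqfreeMonomial_dvd h) hB

theorem mem_span_singleton_sqfreeMonomial_iff {T : Finset σ} {p : MvPolynomial σ K} :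
    p ∈ Ideal.span {sqfreeMonomial K T} ↔ ∀ d ∈ p.support, T ⊆ d.support := by
  rw [← Set.image_singleton, mem_span_sqfreeMonomial_iff]
  simp

theorem isSqfreeMonomialIdeal_span_singleton (T : Finset σ) :
    IsSqfreeMonomialIdeal (Ideal.span {sqfreeMonomial K T}) :=
  ⟨{T}, by rw [Set.image_singleton]⟩

theorem IsSqfreeMonomialIdeal.sup {J : Ideal (MvPolynomial σ K)} (hI : IsSqfreeMonomialIdeal I)
    (hJ : IsSqfreeMonomialIdeal J) : IsSqfreeMonomialIdeal (I ⊔ J) := by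
  obtain ⟨A, rfl⟩ := hI
  obtain ⟨B, rfl⟩ := hJ
  exact ⟨A ∪ B, by rw [Set.image_union, Ideal.span_union]⟩

theorem IsSqfreeMonomialIdeal.sqfreeMonomial_mem_sup_iff {J : Ideal (MvPolynomial σ K)}
    (hI : IsSqfreeMonomialIdeal I) (hJ : IsSqfreeMonomialIdeal J) {B : Finset σ} :
    sqfreeMonomial K B ∈ I ⊔ J ↔ sqfreeMonomial K B ∈ I ∨ sqfreeMonomial K B ∈ J := by
  obtain ⟨A, rfl⟩ := hI
  obtain ⟨B, rfl⟩ := hJ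
  rw [← Ideal.span_union, ← Set.image_union]
  simp only [sqfreeMonomial_mem_span_iff, Set.mem_union, or_and_right, exists_or]

/-- A squarefree monomial ideal is radical; this is the instance of that fact for multiples of a
variable. -/
theorem IsSqfreeMonomialIdeal.X_mul_mem (hI : IsSqfreeMonomialIdeal I) (i : σ)
    {p : MvPolynomial σ K} (h : X i * (X i * p) ∈ I) : X i * p ∈ I := by
  classical
  rw [hI.mem_iff] at h ⊢
  intro d hd
  have := h (Finsupp.single i 1 + d) (by
    rw [support_X_mul]; simpa using hd)
  have hi : i ∈ d.support := by
    rw [support_X_mul] at hd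
    simp only [Finset.mem_map, addLeftEmbedding_apply] at hd
    obtain ⟨e, -, rfl⟩ := hd
    simp
  convert this using 2
  ext j
  by_cases hj : j = i
  · subst hj; simpa using hi
  · simp [Ne.symm hj]

theorem X_dvd_iff_forall_support {i : σ} {p : MvPolynomial σ K} :
    X i ∣ p ↔ ∀ d ∈ p.support, i ∈ d.support := by
  have := mem_span_singleton_sqfreeMonomial_iff (T := {i}) (p := p)
  rw [Ideal.mem_span_singleton] at this
  simpa [sqfreeMonomial] using this

theorem sqfreeMonomial_dvd_iff {T : Finset σ} {p : MvPolynomial σ K} :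
    sqfreeMonomial K T ∣ p ↔ ∀ i ∈ T, X i ∣ p := by
  rw [← Ideal.mem_span_singleton, mem_span_singleton_sqfreeMonomial_iff]
  simp only [X_dvd_iff_forall_support, Finset.subset_iff]
  tauto

end Monomial

/-! ### First Koszul cohomology modulo one squarefree monomial -/

section Koszul

variable {K : Type*} [Field K]

theorem coeff_X_mul_of_add (n : ℕ) (i : Fin n) (e : Fin n →₀ ℕ) (p : MvPolynomial (Fin n) K) :
    coeff (e + Finsupp.single i 1) (X i * p) = coeff e p := by
  rw [add_comm, coeff_X_mul]

/-- The first Koszul cohomology of `x_0, …, x_3` on `S / (x_T)` vanishes. -/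
theorem exists_coboundary_mod_sqfreeMonomial (T : Finset (Fin 4))
    (a : Fin 4 → MvPolynomial (Fin 4) K)
    (ha : ∀ i j, X j * a i - X i * a j ∈ Ideal.span {sqfreeMonomial K T}) :
    ∃ c, ∀ i, a i - X i * c ∈ Ideal.span {sqfreeMonomial K T} := by
  classical
  have third (p q : Fin 4) : ∃ k, k ∉ ({p, q} : Finset (Fin 4)) := by
    by_contra! hall
    have := Finset.card_le_card (Finset.subset_iff.mpr fun k (_ : k ∈ Finset.univ) => hall k)
    have := this.trans Finset.card_le_two
    simp at this
  have supp (e : Fin 4 →₀ ℕ) (i : Fin 4) :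
      (e + Finsupp.single i 1).support = insert i e.support := by
    ext j
    by_cases hj : j = i
    · subst hj; simp
    · simp [hj]
  have step (e : Fin 4 →₀ ℕ) (i j : Fin 4) (h : ¬ T ⊆ insert i (insert j e.support)) :
      coeff (e + Finsupp.single i 1) (a i) = coeff (e + Finsupp.single j 1) (a j) := by
    have h1 := (mem_span_singleton_sqfreeMonomial_iff.mp (ha i j))
      (e + Finsupp.single i 1 + Finsupp.single j 1)
    rw [supp, supp, Finset.insert_comm] at h1
    have h2 := mt h1 h
    rw [notMem_support_iff, coeff_sub, sub_eq_zero, coeff_X_mul_of_add, add_right_comm,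
      coeff_X_mul_of_add] at h2
    exact h2
  -- The coefficient of `c` at `e` has to be this common value. When the cocycle condition for `i,
  -- j` says nothing, a third index `k` links them: `j ∈ T` is still missing for the pair `i, k`,
  -- and `i ∈ T` for `j, k`.
  have indep (e : Fin 4 →₀ ℕ) (i j : Fin 4) (hi : ¬ T ⊆ insert i e.support)
      (hj : ¬ T ⊆ insert j e.support) :
      coeff (e + Finsupp.single i 1) (a i) = coeff (e + Finsupp.single j 1) (a j) := by
    by_cases h : T ⊆ insert i (insert j e.support)
    · obtain ⟨p, hpT, hp⟩ := Finset.not_subset.mp hi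
      obtain ⟨q, hqT, hq⟩ := Finset.not_subset.mp hj
      have hpj : p = j := by
        have := h hpT
        simp only [Finset.mem_insert, not_or] at this hp
        tauto
      have hqi : q = i := by
        have := h hqT
        simp only [Finset.mem_insert, not_or] at this hq
        tauto
      subst hpj hqi
      obtain ⟨k, hk⟩ := third p q
      simp only [Finset.mem_insert, Finset.mem_singleton, not_or] at hk hp hq
      rw [step e q k, step e k p]
      · exact fun hT => by simpa [Ne.symm hk.2, hq] using hT hqT
      · exact fun hT => by simpa [Ne.symm hk.1, hp] using hT hpT
    · exact step e i j h
  let f : (Fin 4 →₀ ℕ) → K := fun e =>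
    if h : ∃ i, ¬ T ⊆ insert i e.support then coeff (e + Finsupp.single h.choose 1) (a h.choose)
    else 0
  let s : Finset (Fin 4 →₀ ℕ) :=
    Finset.univ.biUnion fun i => (a i).support.image fun d => d - Finsupp.single i 1
  have hfs (e) (he : e ∉ s) : f e = 0 := by
    simp only [f]
    split_ifs with h
    · by_contra h0
      refine he (Finset.mem_biUnion.mpr ⟨h.choose, Finset.mem_univ _,
        Finset.mem_image.mpr ⟨_, mem_support_iff.mpr h0, ?_⟩⟩)
      simp
    · rfl
  have hc (e) : coeff e (∑ d ∈ s, monomial d (f d)) = f e := by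
    rw [coeff_sum]
    simp only [coeff_monomial]
    rw [Finset.sum_ite_eq' s e f]
    split_ifs with h
    · rfl
    · exact (hfs e h).symm
  refine ⟨∑ d ∈ s, monomial d (f d), fun i => ?_⟩
  rw [mem_span_singleton_sqfreeMonomial_iff]
  intro d hd
  by_contra hT
  refine mem_support_iff.mp hd ?_
  rw [coeff_sub, sub_eq_zero, coeff_X_mul']
  split_ifs with hi
  · obtain ⟨e, rfl⟩ : ∃ e, d = e + Finsupp.single i 1 := by
      refine ⟨d - Finsupp.single i 1, (tsub_add_cancel_of_le ?_).symm⟩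
      simpa [Finsupp.single_le_iff, Nat.one_le_iff_ne_zero] using hi
    rw [add_tsub_cancel_right, hc]
    rw [supp] at hT
    have h : ∃ i, ¬ T ⊆ insert i e.support := ⟨i, hT⟩
    simp only [f, dif_pos h]
    exact indep e _ _ hT h.choose_spec
  -- Here `x_i` does not divide the monomial, so its coefficient in `a i` must vanish. Compare with
  -- `a k` after multiplying by `x_k`, where `k ≠ p` keeps `T` uncovered.
  · obtain ⟨p, hpT, hp⟩ := Finset.not_subset.mp hT
    obtain ⟨k, hk⟩ := third p i
    simp only [Finset.mem_insert, Finset.mem_singleton, not_or] at hk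
    have h1 := (mem_span_singleton_sqfreeMonomial_iff.mp (ha i k)) (d + Finsupp.single k 1)
    rw [supp] at h1
    have h2 := mt h1 fun h => by simpa [Ne.symm hk.1, hp] using h hpT
    rw [notMem_support_iff, coeff_sub, sub_eq_zero, coeff_X_mul_of_add, coeff_X_mul', supp,
      if_neg] at h2
    · exact h2
    · simpa [Ne.symm hk.2] using hi

end Koszul

/-! ### Associated primes and the shape of `I` -/

section Associated

variable {K : Type*} [Field K]

theorem ringKrullDim_quotient_add_one_le {R : Type*} [CommRing R] {P Q : Ideal R} [P.IsPrime]
    (h : P < Q) : ringKrullDim (R ⧸ Q) + 1 ≤ ringKrullDim (R ⧸ P) := by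
  obtain ⟨q, hqQ, hqP⟩ := Set.exists_of_ssubset h
  have hq : Ideal.Quotient.mk P q ∈ nonZeroDivisors (R ⧸ P) :=
    mem_nonZeroDivisors_of_ne_zero (by rwa [ne_eq, Ideal.Quotient.eq_zero_iff_mem])
  refine ringKrullDim_succ_le_of_surjective (Ideal.Quotient.factor h.le)
    (Ideal.Quotient.factor_surjective h.le) hq ?_
  rwa [Ideal.Quotient.factor_mk, Ideal.Quotient.eq_zero_iff_mem]

theorem ringKrullDim_quotient_span_X_le (i : Fin 4) :
    ringKrullDim (MvPolynomial (Fin 4) K ⧸ Ideal.span {(X i : MvPolynomial (Fin 4) K)}) ≤ 3 := by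
  have h1 := ringKrullDim_quotient_succ_le_of_nonZeroDivisor
    (mem_nonZeroDivisors_of_ne_zero (X_ne_zero (R := K) i))
  rw [MvPolynomial.ringKrullDim_of_isNoetherianRing, ringKrullDim_eq_zero_of_field] at h1
  simp only [Nat.card_eq_fintype_card, Fintype.card_fin, zero_add] at h1
  have h4 : ((4 : ℕ) : WithBot ℕ∞) = 3 + 1 := by norm_num
  rw [h4] at h1
  exact (ENat.WithBot.add_le_add_one_right_iff).mp h1

/-- The prime `(x_i)` already has a quotient of dimension at most 3, and a strictly larger prime
would lose a dimension. -/
theorem eq_span_X_of_ringKrullDim_eq {Q : Ideal (MvPolynomial (Fin 4) K)} {i : Fin 4}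
    (hi : X i ∈ Q) (hQ : ringKrullDim (MvPolynomial (Fin 4) K ⧸ Q) = 3) :
    Q = Ideal.span {X i} := by
  by_contra hne
  have hle : Ideal.span {X i} ≤ Q := (Ideal.span_singleton_le_iff_mem _).mpr hi
  have : (Ideal.span {(X i : MvPolynomial (Fin 4) K)}).IsPrime :=
    (Ideal.span_singleton_prime (X_ne_zero i)).mpr (X_prime)
  have h1 := ringKrullDim_quotient_add_one_le (lt_of_le_of_ne hle (Ne.symm hne))
  have h2 := h1.trans (ringKrullDim_quotient_span_X_le i)
  rw [hQ] at h2
  exact absurd h2 (by decide)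

theorem exists_X_mem_of_prime {σ : Type*} {I Q : Ideal (MvPolynomial σ K)}
    (hI : IsSqfreeMonomialIdeal I) (hI0 : I ≠ ⊥) (hQ : Q.IsPrime) (hIQ : I ≤ Q) :
    ∃ i, X i ∈ Q := by
  obtain ⟨A, rfl⟩ := hI
  obtain ⟨s, hs⟩ : A.Nonempty := by
    rw [Set.nonempty_iff_ne_empty]
    rintro rfl
    simp at hI0
  have := hIQ (Ideal.subset_span (Set.mem_image_of_mem _ hs))
  obtain ⟨i, -, hi⟩ := (Ideal.IsPrime.prod_mem_iff (hp := hQ)).mp this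
  exact ⟨i, hi⟩

variable {I J : Ideal (MvPolynomial (Fin 4) K)}

/-- If all associated primes of `J / I` have height one, then `I = J ∩ (x_T)` where
`Ass (J / I) = {(x_i) : i ∈ T}`. -/
theorem exists_eq_inf_span_sqfreeMonomial
    (hI : IsSqfreeMonomialIdeal I) (hI0 : I ≠ ⊥) (hIJ : I < J)
    (hAss : ∀ Q ∈ associatedPrimes (MvPolynomial (Fin 4) K) (IdealQuotient I J),
      ringKrullDim (MvPolynomial (Fin 4) K ⧸ Q) = 3) :
    ∃ T : Finset (Fin 4), T.Nonempty ∧ I = J ⊓ Ideal.span {sqfreeMonomial K T} ∧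
      ∀ i ∈ T, ∃ m ∈ J, m ∉ I ∧ X i * m ∈ I := by
  classical
  have colon_mem (x : J) (r : MvPolynomial (Fin 4) K) :
      r ∈ (⊥ : Submodule _ (IdealQuotient I J)).colon {Submodule.Quotient.mk x} ↔
        r * x ∈ I := by
    rw [Submodule.mem_colon_singleton, Submodule.mem_bot, ← Submodule.Quotient.mk_smul,
      idealQuotient_mk_eq_zero_iff]
    rfl
  have form (Q : Ideal (MvPolynomial (Fin 4) K)) (hQ : IsAssociatedPrime Q (IdealQuotient I J)) :
      (∃ i, Q = Ideal.span {X i}) ∧ ∃ x ∈ J, ∀ r, r ∈ Q ↔ r * x ∈ I := by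
    have hdim := hAss Q hQ
    obtain ⟨hp, y, hy⟩ := isAssociatedPrime_iff.mp hQ
    obtain ⟨x, rfl⟩ := Submodule.Quotient.mk_surjective _ y
    have hx (r) : r ∈ Q ↔ r * x ∈ I := by rw [hy]; exact colon_mem x r
    obtain ⟨i, hi⟩ := exists_X_mem_of_prime hI hI0 hp fun r hr => by
      rw [hx]; exact I.mul_mem_right _ hr
    exact ⟨⟨i, eq_span_X_of_ringKrullDim_eq hi hdim⟩, x, x.2, hx⟩
  have exist (m : MvPolynomial (Fin 4) K) (hm : m ∈ J) (hmI : m ∉ I) :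
      ∃ i : Fin 4, IsAssociatedPrime (Ideal.span {(X i : MvPolynomial (Fin 4) K)}) (IdealQuotient I J) ∧
        ∃ s, s * m ∉ I ∧ X i * (s * m) ∈ I := by
    let y : IdealQuotient I J := Submodule.Quotient.mk ⟨m, hm⟩
    have hy : y ≠ 0 := by rwa [ne_eq, idealQuotient_mk_eq_zero_iff]
    -- Working in the cyclic submodule makes the element with annihilator `(x_i)` a multiple of `m`.
    let N := Submodule.span (MvPolynomial (Fin 4) K) {y}
    obtain ⟨Q, hQ, -⟩ := exists_le_isAssociatedPrime_of_isNoetherianRing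
      (MvPolynomial (Fin 4) K) (⟨y, Submodule.mem_span_singleton_self y⟩ : N)
      (fun h => hy (congrArg Subtype.val h))
    have hQ' := hQ.map_of_injective (f := N.subtype) N.injective_subtype
    obtain ⟨⟨i, rfl⟩, -⟩ := form Q hQ'
    obtain ⟨hp, ⟨z, hz⟩, hzQ⟩ := isAssociatedPrime_iff.mp hQ
    obtain ⟨s, rfl⟩ := Submodule.mem_span_singleton.mp hz
    have key (r : MvPolynomial (Fin 4) K) :
        r ∈ Ideal.span {(X i : MvPolynomial (Fin 4) K)} ↔ r * (s * m) ∈ I := by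
      rw [hzQ, Submodule.mem_colon_singleton, Submodule.mem_bot, ← Subtype.coe_inj]
      change r • s • y = 0 ↔ _
      rw [← Submodule.Quotient.mk_smul, ← Submodule.Quotient.mk_smul,
        idealQuotient_mk_eq_zero_iff]
      rfl
    refine ⟨i, hQ', s, fun h => hp.ne_top ((Ideal.eq_top_iff_one _).mpr ((key 1).mpr ?_)),
      (key _).mp (Ideal.mem_span_singleton_self _)⟩
    rwa [one_mul]
  let T : Finset (Fin 4) :=
    Finset.univ.filter fun i =>
      IsAssociatedPrime (Ideal.span {(X i : MvPolynomial (Fin 4) K)}) (IdealQuotient I J)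
  have hT (i) : i ∈ T ↔
      IsAssociatedPrime (Ideal.span {(X i : MvPolynomial (Fin 4) K)}) (IdealQuotient I J) := by simp [T]
  refine ⟨T, ?_, le_antisymm (le_inf hIJ.le fun p hp => ?_) fun m hm => ?_, fun i hi => ?_⟩
  · obtain ⟨m, hm, hmI⟩ := Set.exists_of_ssubset hIJ
    obtain ⟨i, hi, -⟩ := exist m hm hmI
    exact ⟨i, (hT i).mpr hi⟩
  · rw [Ideal.mem_span_singleton, sqfreeMonomial_dvd_iff]
    intro i hi
    obtain ⟨-, x, hx, h⟩ := form _ ((hT i).mp hi)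
    rw [← Ideal.mem_span_singleton, h]
    exact I.mul_mem_right _ hp
  · obtain ⟨hmJ, hmT⟩ := Submodule.mem_inf.mp hm
    by_contra hmI
    rw [Ideal.mem_span_singleton, sqfreeMonomial_dvd_iff] at hmT
    obtain ⟨i, hi, s, hs, hs'⟩ := exist m hmJ hmI
    -- Now `m = x_i m'`, so `x_i² s m' ∈ I`, and radicality gives `s m ∈ I`, a contradiction.
    obtain ⟨m', rfl⟩ := hmT i ((hT i).mpr hi)
    rw [mul_left_comm s] at hs hs'
    exact hs (hI.X_mul_mem i hs')
  · obtain ⟨-, x, hx, h⟩ := form _ ((hT i).mp hi)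
    refine ⟨x, hx, fun hxI => ?_, (h _).mp (Ideal.mem_span_singleton_self _)⟩
    have := ((hT i).mp hi).1.ne_top
    exact this ((Ideal.eq_top_iff_one _).mpr ((h 1).mpr (by simpa using hxI)))

end Associated

/-! ### What the depth of `J / I` says about `J + (x_T)` -/

section Depth

open RingTheory.Sequence

variable {K : Type*} [Field K]

/-- By the second isomorphism theorem; the new denominator `U` is later the principal ideal `(x_T)`,
whose cohomology is known. -/
theorem isRegular_idealQuotient_sup {R : Type*} [CommRing R] {I J U : Ideal R} (h : I = J ⊓ U)
    {rs : List R} (hrs : IsRegular (IdealQuotient I J) rs) :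
    IsRegular (IdealQuotient U (J ⊔ U)) rs := by
  subst h
  exact ((LinearMap.quotientInfEquivSupQuotient J U).isRegular_congr rs).mp hrs

variable {I J : Ideal (MvPolynomial (Fin 4) K)} {T : Finset (Fin 4)}

/-- The annihilator contains `I ≠ 0`, and a nonzero ideal of a four-dimensional domain has a
quotient of dimension at most 3. -/
theorem length_le_three_of_isRegular (hI0 : I ≠ ⊥) {rs : List (MvPolynomial (Fin 4) K)}
    (h : IsRegular (IdealQuotient I J) rs) : rs.length ≤ 3 := by
  have h1 := length_le_supportDim rs _ h
  rw [Module.supportDim_eq_ringKrullDim_quotient_annihilator] at h1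
  have hann : I ≤ Module.annihilator (MvPolynomial (Fin 4) K) (IdealQuotient I J) := by
    intro r hr
    rw [Module.mem_annihilator]
    intro y
    obtain ⟨x, rfl⟩ := Submodule.Quotient.mk_surjective _ y
    rw [← Submodule.Quotient.mk_smul, idealQuotient_mk_eq_zero_iff]
    exact I.mul_mem_right _ hr
  have h2 := ringKrullDim_quotient_add_one_le
    (lt_of_lt_of_le (bot_lt_iff_ne_bot.mpr hI0) hann)
  rw [(RingEquiv.quotientBot (MvPolynomial (Fin 4) K)).ringKrullDim,
    MvPolynomial.ringKrullDim_of_isNoetherianRing, ringKrullDim_eq_zero_of_field] at h2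
  have h3 : ((rs.length : ℕ) : WithBot ℕ∞) + 1 ≤ 0 + (Nat.card (Fin 4) : ℕ) :=
    le_trans (by gcongr) h2
  rw [zero_add, Nat.card_eq_fintype_card, Fintype.card_fin] at h3
  have h4 : rs.length + 1 ≤ 4 := by
    have : (((rs.length + 1 : ℕ) : ℕ∞) : WithBot ℕ∞) ≤ ((4 : ℕ) : ℕ∞) := by
      push_cast; exact_mod_cast h3
    exact_mod_cast (WithBot.coe_le_coe.mp this)
  omega

/-- No `x_i` with `i ∈ T` divides `f`, because `x_i` kills a nonzero class of `J / I`; hence `f` is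
prime to `x_T`. -/
theorem mem_of_mul_mem_span_sqfreeMonomial
    (hT : ∀ i ∈ T, ∃ m ∈ J, m ∉ I ∧ X i * m ∈ I) {f : MvPolynomial (Fin 4) K}
    {rs : List (MvPolynomial (Fin 4) K)} (h : IsRegular (IdealQuotient I J) (f :: rs))
    (z : MvPolynomial (Fin 4) K) (hz : f * z ∈ Ideal.span {sqfreeMonomial K T}) :
    z ∈ Ideal.span {sqfreeMonomial K T} := by
  rw [Ideal.mem_span_singleton, sqfreeMonomial_dvd_iff] at hz ⊢
  intro i hi
  refine (X_prime.dvd_or_dvd (hz i hi)).resolve_left fun hf => ?_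
  obtain ⟨m, hm, hmI, hmX⟩ := hT i hi
  obtain ⟨q, rfl⟩ := hf
  refine hmI (mem_of_isRegular_first h hm ?_)
  rw [mul_right_comm]
  exact I.mul_mem_right _ hmX

theorem one_mem_of_isRegular_pair (hI : I = J ⊓ Ideal.span {sqfreeMonomial K T})
    (hT : ∀ i ∈ T, ∃ m ∈ J, m ∉ I ∧ X i * m ∈ I) {f g : MvPolynomial (Fin 4) K}
    {rs : List (MvPolynomial (Fin 4) K)} (h : IsRegular (IdealQuotient I J) (f :: g :: rs))
    (hf : f ∈ idealOfVars (Fin 4) K) (hg : g ∈ idealOfVars (Fin 4) K)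
    (hX : ∀ i, X i ∈ J ⊔ Ideal.span {sqfreeMonomial K T}) :
    1 ∈ J ⊔ Ideal.span {sqfreeMonomial K T} := by
  refine mem_of_isRegular_pair le_sup_right (isRegular_idealQuotient_sup hI h) hf hg
    (mem_of_mul_mem_span_sqfreeMonomial hT h) ?_
  rintro _ ⟨i, rfl⟩
  rw [mul_one]
  exact hX i

theorem exists_coboundary_sup (hI : I = J ⊓ Ideal.span {sqfreeMonomial K T})
    (hT : ∀ i ∈ T, ∃ m ∈ J, m ∉ I ∧ X i * m ∈ I) {f g k : MvPolynomial (Fin 4) K}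
    {rs : List (MvPolynomial (Fin 4) K)} (h : IsRegular (IdealQuotient I J) (f :: g :: k :: rs))
    (hf : f ∈ idealOfVars (Fin 4) K) (hg : g ∈ idealOfVars (Fin 4) K)
    (hk : k ∈ idealOfVars (Fin 4) K) (a : Fin 4 → MvPolynomial (Fin 4) K)
    (ha : ∀ i j, X j * a i - X i * a j ∈ J ⊔ Ideal.span {sqfreeMonomial K T}) :
    ∃ c, ∀ i, a i - X i * c ∈ J ⊔ Ideal.span {sqfreeMonomial K T} :=
  exists_coboundary_of_isRegular_triple X (isRegular_idealQuotient_sup hI h) le_sup_right hf hg hk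
    (mem_of_mul_mem_span_sqfreeMonomial hT h) (exists_coboundary_mod_sqfreeMonomial T) a ha

end Depth

/-! ### Cocycles detecting a one-point or disconnected complex -/

section Cocycle

variable {K : Type*} [Field K] {n : ℕ} {J : Ideal (MvPolynomial (Fin n) K)}

/-- If the first Koszul cohomology of `S / J` vanishes and `J` is a proper squarefree monomial
ideal, then the simplicial complex of `J` is not a single point. -/
theorem exists_X_notMem_of_cohomology (hJ : IsSqfreeMonomialIdeal J)
    (h : ∀ a : Fin n → MvPolynomial (Fin n) K, (∀ i j, X j * a i - X i * a j ∈ J) →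
      ∃ c, ∀ i, a i - X i * c ∈ J) (h1 : (1 : MvPolynomial (Fin n) K) ∉ J) (l : Fin n) :
    ∃ i, i ≠ l ∧ X i ∉ J := by
  by_contra! hl
  -- If `l` is the only possible vertex, this is a cocycle. Were it a coboundary, `1 - x_l c ∈ J`,
  -- and its constant term would put `1` in `J`.
  obtain ⟨c, hc⟩ := h (Pi.single l 1) fun i j => by
    by_cases hi : i = l
    · subst hi
      by_cases hj : j = i
      · subst hj; simp
      · simpa [hj] using hl j hj
    · by_cases hj : j = l
      · subst hj
        simpa [hi] using hl i hi
      · simp [hi, hj]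
  have := (hJ.mem_iff.mp (hc l)) 0 (by
    rw [mem_support_iff, Pi.single_eq_same, coeff_sub, coeff_X_mul']
    simp)
  exact h1 (by simpa [sqfreeMonomial] using this)

/-- If the first Koszul cohomology of `S / J` vanishes, then the simplicial complex of `J` is
connected. -/
theorem exists_X_mul_X_notMem_of_cohomology (hJ : IsSqfreeMonomialIdeal J)
    (h : ∀ a : Fin n → MvPolynomial (Fin n) K, (∀ i j, X j * a i - X i * a j ∈ J) →
      ∃ c, ∀ i, a i - X i * c ∈ J) {V : Finset (Fin n)} {i j : Fin n} (hiV : i ∈ V) (hjV : j ∉ V)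
    (hi : X i ∉ J) (hj : X j ∉ J) : ∃ p ∈ V, ∃ q ∉ V, X p * X q ∉ J := by
  by_contra! hV
  -- The indicator function of `V`, a union of components. The constant term of `c` would be 1
  -- because of `i` and 0 because of `j`.
  obtain ⟨c, hc⟩ := h (fun i => if i ∈ V then X i else 0) fun p q => by
    by_cases hp : p ∈ V <;> by_cases hq : q ∈ V <;> simp only [hp, hq, if_true, if_false]
    · rw [mul_comm, sub_self]; exact J.zero_mem
    · rw [mul_zero, sub_zero, mul_comm]; exact hV p hp q hq
    · rw [mul_zero, zero_sub]; exact J.neg_mem (hV q hq p hp |> fun h => by rwa [mul_comm])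
    · simp
  have key (l : Fin n) (p : MvPolynomial (Fin n) K) (hl : X l * p ∈ J) (hlJ : X l ∉ J) :
      coeff 0 p = 0 := by
    by_contra h0
    refine hlJ ?_
    have := (hJ.mem_iff.mp hl) (Finsupp.single l 1) (by
      rw [mem_support_iff, coeff_X_mul']
      simpa using h0)
    rw [Finsupp.support_single _ one_ne_zero] at this
    simpa [sqfreeMonomial] using this
  have h1 := key i (1 - c) (by simpa [hiV, mul_sub] using hc i) hi
  have h2 := key j (-c) (by simpa [hjV] using hc j) hj
  rw [coeff_sub, coeff_zero_one] at h1
  rw [coeff_neg, neg_eq_zero] at h2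
  rw [h2] at h1
  simp at h1

end Cocycle

/-! ### From interval partitions to Stanley decompositions -/

section Interval

variable {σ K : Type*} [Field K]

theorem support_mem_interval {A B : Finset σ} (hAB : A ⊆ B) {f : MvPolynomial σ K}
    (hf : f ∈ supported K (B : Set σ)) {d : σ →₀ ℕ} (hd : d ∈ (f * sqfreeMonomial K A).support) :
    A ⊆ d.support ∧ d.support ⊆ B := by
  classical
  constructor
  · exact mem_span_singleton_sqfreeMonomial_iff.mp
      (Ideal.mem_span_singleton.mpr (dvd_mul_left _ _)) d hd
  · have h : f * sqfreeMonomial K A ∈ supported K (B : Set σ) :=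
      Subalgebra.mul_mem _ hf (Subalgebra.prod_mem _ fun i hi => X_mem_supported.mpr (hAB hi))
    intro i hi
    exact mem_supported.mp h ((mem_vars_iff_mem_support _).mpr ⟨d, hd, hi⟩)

theorem monomial_mem_supported {B : Finset σ} {d : σ →₀ ℕ} (hd : d.support ⊆ B) (c : K) :
    monomial d c ∈ supported K (B : Set σ) := by
  classical
  rw [mem_supported]
  refine subset_trans ?_ (Finset.coe_subset.mpr hd)
  intro i hi
  obtain ⟨e, he, hie⟩ := (mem_vars_iff_mem_support _).mp hi
  rw [Finset.mem_singleton.mp (support_monomial_subset he)] at hie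
  exact hie

variable {I J : Ideal (MvPolynomial σ K)}

/-- A partition into intervals of the set of squarefree monomials in `J \ I`. -/
structure IsIntervalPartition (I J : Ideal (MvPolynomial σ K))
    (D : Finset (Finset σ × Finset σ)) : Prop where
  subset : ∀ P ∈ D, P.1 ⊆ P.2
  mem : ∀ P ∈ D, sqfreeMonomial K P.1 ∈ J
  notMem : ∀ P ∈ D, sqfreeMonomial K P.2 ∉ I
  exists_mem : ∀ C, sqfreeMonomial K C ∈ J → sqfreeMonomial K C ∉ I →
    ∃ P ∈ D, P.1 ⊆ C ∧ C ⊆ P.2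
  unique : ∀ P ∈ D, ∀ Q ∈ D, ∀ C, P.1 ⊆ C → C ⊆ P.2 → Q.1 ⊆ C → C ⊆ Q.2 → P = Q

namespace IsIntervalPartition

variable {D : Finset (Finset σ × Finset σ)}

/-- The class of the generator of an interval. -/
def gen (h : IsIntervalPartition I J D) (P : D) : IdealQuotient I J :=
  Submodule.Quotient.mk ⟨sqfreeMonomial K P.1.1, h.mem P P.2⟩

theorem exists_of_mem_polySpan (h : IsIntervalPartition I J D) (P : D) {x : IdealQuotient I J}
    (hx : x ∈ polySpan (K := K) (h.gen P) P.1.2) :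
    ∃ g : J, x = Submodule.Quotient.mk g ∧
      ∀ d ∈ (g : MvPolynomial σ K).support, P.1.1 ⊆ d.support ∧ d.support ⊆ P.1.2 := by
  obtain ⟨f, hf⟩ := Submodule.mem_span_singleton.mp hx
  let y : J := ⟨sqfreeMonomial K P.1.1, h.mem P P.2⟩
  refine ⟨(f : MvPolynomial σ K) • y, ?_, fun d hd => ?_⟩
  · rw [← hf, Submodule.Quotient.mk_smul]
    rfl
  · exact support_mem_interval (h.subset P P.2) f.2 hd

/-- Summands of different intervals have no monomial in common, so nothing cancels in a sum lying in
`I`. -/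
theorem iSupIndep (h : IsIntervalPartition I J D) (hI : IsSqfreeMonomialIdeal I) :
    iSupIndep fun P : D => (polySpan (K := K) (h.gen P) P.1.2).restrictScalars K := by
  classical
  rw [iSupIndep_iff_finsetSum_eq_zero_imp_eq_zero]
  intro s p hp hsum
  choose! g hg hgs using fun P hP => h.exists_of_mem_polySpan P (hp P hP)
  intro P hP
  rw [hg P hP, idealQuotient_mk_eq_zero_iff, hI.mem_iff]
  intro d hd
  have hsum' : ∑ Q ∈ s, (g Q : MvPolynomial σ K) ∈ I := by
    have : (Submodule.Quotient.mk (∑ Q ∈ s, g Q) : IdealQuotient I J) = 0 := by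
      rw [← hsum, ← Submodule.mkQ_apply, map_sum]
      exact Finset.sum_congr rfl fun Q hQ => (hg Q hQ).symm
    rw [idealQuotient_mk_eq_zero_iff] at this
    simpa using this
  refine hI.mem_iff.mp hsum' d ?_
  rw [mem_support_iff, coeff_sum, Finset.sum_eq_single P]
  · exact mem_support_iff.mp hd
  · intro Q hQ hQP
    by_contra h0
    have h1 := hgs Q hQ d (mem_support_iff.mpr h0)
    have h2 := hgs P hP d hd
    exact hQP (Subtype.ext (h.unique Q Q.2 P P.2 _ h1.1 h1.2 h2.1 h2.2))
  · exact fun h => absurd hP h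

theorem iSup_eq_top (h : IsIntervalPartition I J D) (hI : IsSqfreeMonomialIdeal I)
    (hJ : IsSqfreeMonomialIdeal J) :
    ⨆ P : D, (polySpan (K := K) (h.gen P) P.1.2).restrictScalars K = ⊤ := by
  classical
  set N := ⨆ P : D, (polySpan (K := K) (h.gen P) P.1.2).restrictScalars K with hN
  let N' : Submodule K (MvPolynomial σ K) :=
    (N.comap ((Submodule.mkQ (Submodule.submoduleOf I J)).restrictScalars K)).map
      ((Submodule.subtype J).restrictScalars K)
  rw [eq_top_iff]
  rintro x -
  obtain ⟨p, rfl⟩ := Submodule.Quotient.mk_surjective _ x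
  suffices hp : (p : MvPolynomial σ K) ∈ N' by
    obtain ⟨q, hq, hqp⟩ := hp
    rwa [← Subtype.ext hqp]
  rw [as_sum (p : MvPolynomial σ K)]
  refine N'.sum_mem fun d hd => ?_
  have hc : coeff d (p : MvPolynomial σ K) ≠ 0 := mem_support_iff.mp hd
  have hdJ := hJ.mem_iff.mp p.2 d hd
  generalize coeff d (p : MvPolynomial σ K) = c at hc
  refine ⟨⟨monomial d c, (hJ.monomial_mem_iff hc).mpr hdJ⟩, ?_, rfl⟩
  change (Submodule.Quotient.mk _ : IdealQuotient I J) ∈ N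
  by_cases hdI : sqfreeMonomial K d.support ∈ I
  · rw [(idealQuotient_mk_eq_zero_iff _).mpr ((hI.monomial_mem_iff hc).mpr hdI)]
    exact N.zero_mem
  · obtain ⟨P, hP, hP1, hP2⟩ := h.exists_mem _ hdJ hdI
    refine Submodule.mem_iSup_of_mem ⟨P, hP⟩ ?_
    refine Submodule.mem_span_singleton.mpr ⟨⟨monomial (d - sqfreeExponent P.1) c,
      monomial_mem_supported (subset_trans ?_ hP2) c⟩, ?_⟩
    · exact Finsupp.support_mono tsub_le_self
    · change (Submodule.Quotient.mk (monomial (d - sqfreeExponent P.1) c •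
        (⟨sqfreeMonomial K P.1, _⟩ : J)) : IdealQuotient I J) = _
      congr 1
      refine Subtype.ext ?_
      change monomial (d - sqfreeExponent P.1) c * sqfreeMonomial K P.1 = monomial d c
      rw [sqfreeMonomial_eq, monomial_mul, mul_one,
        tsub_add_cancel_of_le (sqfreeExponent_le_iff.mpr hP1)]

/-- Every monomial of `f x_A` has support inside `B`; if it lay in `I`, so would `x_B`. -/
theorem gen_free (h : IsIntervalPartition I J D) (hI : IsSqfreeMonomialIdeal I) (P : D)
    (f : MvPolynomial σ K) (hf : f ∈ supported K (P.1.2 : Set σ)) (h0 : f • h.gen P = 0) :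
    f = 0 := by
  have h1 : f * sqfreeMonomial K P.1.1 ∈ I := (idealQuotient_mk_eq_zero_iff (f •
    (⟨sqfreeMonomial K P.1.1, h.mem P P.2⟩ : J))).mp h0
  by_contra hne
  obtain ⟨d, hd⟩ : (f * sqfreeMonomial K P.1.1).support.Nonempty := by
    rw [support_nonempty, sqfreeMonomial_eq]
    exact mul_ne_zero hne (by simp)
  exact h.notMem P P.2 (sqfreeMonomial_mem_of_subset
    (support_mem_interval (h.subset P P.2) hf hd).2 (hI.mem_iff.mp h1 d hd))

/-- The Stanley decomposition of `J / I` given by an interval partition. -/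
def stanleyDecomposition (h : IsIntervalPartition I J D) (hI : IsSqfreeMonomialIdeal I)
    (hJ : IsSqfreeMonomialIdeal J) : StanleyDecomposition (quotientPiece I J) where
  r := D.card
  m i := h.gen (D.equivFin.symm i)
  Z i := (D.equivFin.symm i).1.2
  homogeneous i := by
    refine ⟨fun j => sqfreeExponent (D.equivFin.symm i).1.1 j, _, ?_, rfl⟩
    change sqfreeMonomial K _ ∈ restrictSupport K _
    rw [sqfreeMonomial_eq, monomial_mem_restrictSupport]
    exact Or.inl fun _ => rfl
  ne_zero i := by
    rw [ne_eq, gen, idealQuotient_mk_eq_zero_iff]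
    exact fun h0 => h.notMem _ (D.equivFin.symm i).2
      (sqfreeMonomial_mem_of_subset (h.subset _ (D.equivFin.symm i).2) h0)
  free i := by
    refine (polySpan_free_iff _ _ ?_).mpr (h.gen_free hI _)
    intro h0
    have := h.gen_free hI (D.equivFin.symm i) 1 (Subalgebra.one_mem _) (by rw [h0, smul_zero])
    exact one_ne_zero this
  isInternal := by
    rw [DirectSum.isInternal_submodule_iff_iSupIndep_and_iSup_eq_top]
    refine ⟨(h.iSupIndep hI).comp D.equivFin.symm.injective, ?_⟩
    rw [← h.iSup_eq_top hI hJ]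
    exact D.equivFin.symm.iSup_comp
      (g := fun P : D => (polySpan (K := K) (h.gen P) P.1.2).restrictScalars K)

theorem le_sdepth (h : IsIntervalPartition I J D) (hI : IsSqfreeMonomialIdeal I)
    (hJ : IsSqfreeMonomialIdeal J) {t : ℕ} (ht : ∀ P ∈ D, t ≤ P.2.card) :
    (t : ℕ∞) ≤ sdepth (quotientPiece I J) :=
  le_iSup_of_le (h.stanleyDecomposition hI hJ) (le_iInf fun i =>
    Nat.cast_le.mpr (ht _ (D.equivFin.symm i).2))

end IsIntervalPartition

end Interval

/-! ### Partitioning nonfaces on four vertices -/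

section Combinatorics

/-- For a simplicial complex on four vertices, let `v` and `e` say which sets of one or two vertices
are nonfaces. If the complex is connected and has at least two vertices, then every nonempty nonface
`T` has an element `k` whose deletion leaves nonfaces closed under intersection, followed (unless
`T = {k}`) by an element `l` for which the same holds in the link of `k`. -/
def HasGoodOrder (v : Fin 4 → Bool) (e : Fin 4 → Fin 4 → Bool) : Prop :=
    (∀ i j, v i → e i j) → (∀ l, ∃ i, i ≠ l ∧ ¬ v i) →
    (∀ V : Finset (Fin 4), (∃ i ∈ V, ¬ v i) → (∃ j, j ∉ V ∧ ¬ v j) →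
      ∃ p ∈ V, ∃ q, q ∉ V ∧ ¬ e p q) →
    ∀ T : Finset (Fin 4), T.Nonempty → (∀ i j, T = {i, j} → e i j) →
    ∃ k ∈ T, (∀ p q r, p ≠ k → q ≠ k → r ≠ k → p ≠ q → p ≠ r → q ≠ r →
        (e p r → ¬ v q) ∧ (e p r → e q r → v r)) ∧
      (T = {k} ∨ ∃ l ∈ T, l ≠ k ∧
        ∀ a b, a ≠ k → a ≠ l → b ≠ k → b ≠ l → a ≠ b → e k a → e k b → v k)

set_option synthInstance.maxHeartbeats 400000 in
set_option synthInstance.maxSize 4000 in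
instance (v : Fin 4 → Bool) (e : Fin 4 → Fin 4 → Bool) : Decidable (HasGoodOrder v e) := by
  unfold HasGoodOrder; infer_instance

/-- Vertices and edges suffice: two incomparable sets omitting `k` have at most two elements each,
and likewise for two incomparable sets containing `k` and omitting `l`. This leaves `2 ^ 10` cases
to check. -/
theorem hasGoodOrder : ∀ v₀ v₁ v₂ v₃ e₀₁ e₀₂ e₀₃ e₁₂ e₁₃ e₂₃ : Bool,
    HasGoodOrder ![v₀, v₁, v₂, v₃] ![![v₀, e₀₁, e₀₂, e₀₃], ![e₀₁, v₁, e₁₂, e₁₃],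
      ![e₀₂, e₁₂, v₂, e₂₃], ![e₀₃, e₁₃, e₂₃, v₃]] := by
  decide +kernel

variable {F : Finset (Fin 4) → Prop} {T : Finset (Fin 4)}

/-- The sets that belong to `F` and do not contain `T` can be partitioned into intervals whose
maximal elements have at least `t` elements. -/
def IsPartitionable {n : ℕ} (F : Finset (Fin n) → Prop) (T : Finset (Fin n)) (t : ℕ) : Prop :=
  ∃ D : Finset (Finset (Fin n) × Finset (Fin n)),
    (∀ P ∈ D, P.1 ⊆ P.2 ∧ F P.1 ∧ ¬ T ⊆ P.2 ∧ t ≤ P.2.card) ∧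
    (∀ C, F C → ¬ T ⊆ C → ∃ P ∈ D, P.1 ⊆ C ∧ C ⊆ P.2) ∧
    ∀ P ∈ D, ∀ Q ∈ D, ∀ C, P.1 ⊆ C → C ⊆ P.2 → Q.1 ⊆ C → C ⊆ Q.2 → P = Q

/-- One-element intervals suffice, since no set involved is empty. -/
theorem isPartitionable_of_empty (h0 : ¬ F ∅) : IsPartitionable F T 1 := by
  classical
  refine ⟨(Finset.univ.filter fun C => F C ∧ ¬ T ⊆ C).image fun C => (C, C), ?_, ?_, ?_⟩
  · simp only [Finset.mem_image, Finset.mem_filter, Finset.mem_univ, true_and]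
    rintro _ ⟨C, ⟨hF, hT⟩, rfl⟩
    refine ⟨subset_rfl, hF, hT, Finset.card_pos.mpr ?_⟩
    rw [Finset.nonempty_iff_ne_empty]
    rintro rfl
    exact h0 hF
  · intro C hF hT
    exact ⟨(C, C), by simp [hF, hT], subset_rfl, subset_rfl⟩
  · simp only [Finset.mem_image, Finset.mem_filter, Finset.mem_univ, true_and]
    rintro _ ⟨A, -, rfl⟩ _ ⟨B, -, rfl⟩ C h1 h2 h3 h4
    obtain rfl : A = B := (subset_antisymm h1 h2).trans (subset_antisymm h3 h4).symm
    rfl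

theorem isPartitionable_two (hmono : ∀ A B, A ⊆ B → F A → F B) (hT : T.Nonempty) (hFT : F T)
    {l : Fin 4} (hl : ¬ F {l}) : IsPartitionable F T 2 := by
  classical
  have hTl : T ≠ {l} := by rintro rfl; exact hl hFT
  have sing : ∀ i : Fin 4, T ⊆ {i} → T = {i} := fun i h =>
    (Finset.subset_singleton_iff.mp h).resolve_left hT.ne_empty
  have hφ : ∃ φ : Fin 4 → Fin 4, (∀ i, i ≠ l → T ≠ {i} → φ i ≠ i ∧ ¬ T ⊆ {i, φ i}) ∧
      ∀ i, φ i ≠ l → T = {i, l} := by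
    have third : ∀ p q : Fin 4, ∃ k, k ≠ p ∧ k ≠ q := by decide
    choose a ha using third
    -- The singleton `{i}` is enlarged by `l`, which never is such a singleton itself, except when
    -- this would produce `T`.
    refine ⟨fun i => if T = {i, l} then a i l else l, fun i hi hTi => ?_, fun i h => ?_⟩
    · dsimp only
      split_ifs with h
      · refine ⟨(ha i l).1, fun hsub => ?_⟩
        have : l ∈ ({i, a i l} : Finset (Fin 4)) := hsub (by simp [h])
        simp only [Finset.mem_insert, Finset.mem_singleton] at this
        exact this.elim (fun h => hi h.symm) fun h => (ha i l).2 h.symm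
      · refine ⟨hi.symm, fun hsub => ?_⟩
        rw [Finset.subset_iff] at hsub
        simp only [Finset.mem_insert, Finset.mem_singleton] at hsub
        by_cases hiT : i ∈ T
        · by_cases hlT : l ∈ T
          · refine h (subset_antisymm (fun x hx => by simpa using hsub hx) fun x hx => ?_)
            rcases Finset.mem_insert.mp hx with rfl | hx
            · exact hiT
            · rwa [Finset.mem_singleton.mp hx]
          · exact hTi (sing i fun x hx => Finset.mem_singleton.mpr
              ((hsub hx).resolve_right fun h => hlT (h ▸ hx)))
        · exact hTl (sing l fun x hx => Finset.mem_singleton.mpr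
            ((hsub hx).resolve_left fun h => hiT (h ▸ hx)))
    · by_contra hne
      simp [hne] at h
  obtain ⟨φ, hφ1, hφ2⟩ := hφ
  let S : Finset (Fin 4) := Finset.univ.filter fun i => F {i} ∧ T ≠ {i}
  have hS (i) : i ∈ S ↔ F {i} ∧ T ≠ {i} := by simp [S]
  have hSl (i) (hi : i ∈ S) : i ≠ l := by rintro rfl; exact hl ((hS _).mp hi).1
  have hS1 (i) (hi : i ∈ S) := hφ1 i (hSl i hi) ((hS i).mp hi).2
  have hS2 (i) (hi : i ∈ S) (j) (hj : j ∈ S) (h : i ∈ ({j, φ j} : Finset (Fin 4)))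
      (h' : j ∈ ({i, φ i} : Finset (Fin 4))) : i = j := by
    by_contra hne
    simp only [Finset.mem_insert, Finset.mem_singleton, hne, Ne.symm hne, false_or] at h h'
    -- Two singletons could only share a pair if both were exceptional, but `T = {i, l} = {j, l}`
    -- forces `i = j`.
    have h1 := hφ2 j (h ▸ hSl i hi)
    have h2 := hφ2 i (h' ▸ hSl j hj)
    have : i ∈ ({j, l} : Finset (Fin 4)) := by rw [← h1, h2]; simp
    simp only [Finset.mem_insert, Finset.mem_singleton] at this
    exact this.elim hne (hSl i hi)
  have h0 : ¬ F ∅ := fun h => hl (hmono _ _ (Finset.empty_subset _) h)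
  let D₁ := S.image fun i => (({i} : Finset (Fin 4)), ({i, φ i} : Finset (Fin 4)))
  let R : Finset (Finset (Fin 4)) := Finset.univ.filter fun C =>
    F C ∧ ¬ T ⊆ C ∧ 2 ≤ C.card ∧ ∀ i ∈ S, C ≠ {i, φ i}
  let D₂ := R.image fun C => (C, C)
  have hR (C) : C ∈ R ↔ F C ∧ ¬ T ⊆ C ∧ 2 ≤ C.card ∧ ∀ i ∈ S, C ≠ {i, φ i} := by simp [R]
  have hD (P) : P ∈ D₁ ∪ D₂ ↔ (∃ i ∈ S, (({i} : Finset (Fin 4)), {i, φ i}) = P) ∨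
      ∃ C ∈ R, (C, C) = P := by
    simp only [D₁, D₂, Finset.mem_union, Finset.mem_image]
  have mixed (i) (hi : i ∈ S) (B) (hB : B ∈ R) (hBi : B ⊆ {i, φ i}) : False := by
    obtain ⟨-, -, h2, h3⟩ := (hR B).mp hB
    exact h3 i hi (Finset.eq_of_subset_of_card_le hBi (Finset.card_le_two.trans h2))
  refine ⟨D₁ ∪ D₂, ?_, ?_, ?_⟩
  · intro P hP
    rcases (hD P).mp hP with ⟨i, hi, rfl⟩ | ⟨C, hC, rfl⟩
    · refine ⟨by simp, ((hS i).mp hi).1, (hS1 i hi).2, ?_⟩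
      rw [Finset.card_pair (hS1 i hi).1.symm]
    · obtain ⟨h1, h2, h3, -⟩ := (hR C).mp hC
      exact ⟨subset_rfl, h1, h2, h3⟩
  · intro C hFC hTC
    by_cases hc : 2 ≤ C.card
    · by_cases hC : C ∈ R
      · exact ⟨(C, C), (hD _).mpr (Or.inr ⟨C, hC, rfl⟩), subset_rfl, subset_rfl⟩
      · rw [hR] at hC
        push Not at hC
        obtain ⟨i, hi, rfl⟩ := hC hFC hTC hc
        exact ⟨_, (hD _).mpr (Or.inl ⟨i, hi, rfl⟩), by simp, subset_rfl⟩
    · have h1 : C.card = 1 := by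
        have : C.card ≠ 0 := fun h => h0 (Finset.card_eq_zero.mp h ▸ hFC)
        omega
      obtain ⟨i, rfl⟩ := Finset.card_eq_one.mp h1
      refine ⟨_, (hD _).mpr (Or.inl ⟨i, (hS i).mpr ⟨hFC, ?_⟩, rfl⟩), subset_rfl, by simp⟩
      rintro rfl
      exact hTC subset_rfl
  · intro P hP Q hQ C h1 h2 h3 h4
    rcases (hD P).mp hP with ⟨i, hi, rfl⟩ | ⟨A, hA, rfl⟩ <;>
      rcases (hD Q).mp hQ with ⟨j, hj, rfl⟩ | ⟨B, hB, rfl⟩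
    · rw [hS2 i hi j hj (h4 (h1 (by simp))) (h2 (h3 (by simp)))]
    · exact (mixed i hi B hB (h3.trans h2)).elim
    · exact (mixed j hj A hA (h1.trans h4)).elim
    · obtain rfl : A = B := (subset_antisymm h1 h2).trans (subset_antisymm h3 h4).symm
      rfl

/-- If the elements of `T` can be ordered so that, for each `k ∈ T`, the sets in `F` which omit `k`
and contain all elements of `T` before `k` are closed under intersection, then there is a partition
into intervals with maximal elements of cardinality three. -/
theorem isPartitionable_of_order (hmono : ∀ A B, A ⊆ B → F A → F B) (ρ : Fin 4 → ℕ)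
    (hρ : Function.Injective ρ)
    (hinter : ∀ k ∈ T, ∀ A B, F A → F B → k ∉ A → k ∉ B →
      (∀ j ∈ T, ρ j < ρ k → j ∈ A) → (∀ j ∈ T, ρ j < ρ k → j ∈ B) → F (A ∩ B)) :
    IsPartitionable F T 3 := by
  classical
  let P : Fin 4 → Finset (Fin 4) → Prop := fun k B => F B ∧ k ∉ B ∧ ∀ j ∈ T, ρ j < ρ k → j ∈ B
  have hmin (k) (hk : k ∈ T) (h : ∃ B, P k B) : ∃ A, P k A ∧ ∀ B, P k B → A ⊆ B := by
    obtain ⟨B₀, hB₀⟩ := h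
    obtain ⟨A, hA, hAmin⟩ := Finset.exists_min_image (Finset.univ.filter (P k)) Finset.card
      ⟨B₀, by simp [hB₀]⟩
    simp only [Finset.mem_filter, Finset.mem_univ, true_and] at hA hAmin
    refine ⟨A, hA, fun B hB => ?_⟩
    have := hAmin (A ∩ B) ⟨hinter k hk A B hA.1 hB.1 hA.2.1 hB.2.1 hA.2.2 hB.2.2,
      fun h => hA.2.1 (Finset.mem_inter.mp h).1,
      fun j hj hjk => Finset.mem_inter.mpr ⟨hA.2.2 j hj hjk, hB.2.2 j hj hjk⟩⟩
    exact Finset.inter_eq_left.mp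
      (Finset.eq_of_subset_of_card_le Finset.inter_subset_left this)
  choose! A hA hAmin using hmin
  let T' := T.filter fun k => ∃ B, P k B
  have hT' (k) : k ∈ T' ↔ k ∈ T ∧ ∃ B, P k B := by simp [T']
  have hint (k) (hk : k ∈ T') (C) (h1 : A k ⊆ C) (h2 : C ⊆ {k}ᶜ) : P k C := by
    obtain ⟨hkT, hkP⟩ := (hT' k).mp hk
    have := hA k hkT hkP
    exact ⟨hmono _ _ h1 this.1, fun h => by simpa using h2 h,
      fun j hj hjk => h1 (this.2.2 j hj hjk)⟩
  refine ⟨T'.image fun k => (A k, {k}ᶜ), ?_, ?_, ?_⟩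
  · intro Q hQ
    obtain ⟨k, hk, rfl⟩ := Finset.mem_image.mp hQ
    obtain ⟨hkT, hkP⟩ := (hT' k).mp hk
    have := hA k hkT hkP
    refine ⟨?_, this.1, fun h => by simpa using h hkT, by simp [Finset.card_compl]⟩
    intro j hj
    rw [Finset.mem_compl, Finset.mem_singleton]
    rintro rfl
    exact this.2.1 hj
  · intro C hFC hTC
    obtain ⟨k₀, hk₀, hk₀C⟩ := Finset.not_subset.mp hTC
    -- The interval of `C` is indexed by the first element of `T` missing from `C`.
    obtain ⟨k, hk, hkmin⟩ := Finset.exists_min_image (T \ C) ρ ⟨k₀, by simp [hk₀, hk₀C]⟩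
    simp only [Finset.mem_sdiff] at hk hkmin
    have hP : P k C := ⟨hFC, hk.2, fun j hj hjk => by
      by_contra hjC
      exact absurd (hkmin j ⟨hj, hjC⟩) (by omega)⟩
    refine ⟨_, Finset.mem_image_of_mem _ ((hT' k).mpr ⟨hk.1, C, hP⟩),
      hAmin k hk.1 ⟨C, hP⟩ C hP, fun j hj => ?_⟩
    rw [Finset.mem_compl, Finset.mem_singleton]
    rintro rfl
    exact hk.2 hj
  · intro Q hQ Q' hQ' C h1 h2 h3 h4
    obtain ⟨k, hk, rfl⟩ := Finset.mem_image.mp hQ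
    obtain ⟨k', hk', rfl⟩ := Finset.mem_image.mp hQ'
    have hP := hint k hk C h1 h2
    have hP' := hint k' hk' C h3 h4
    rcases lt_trichotomy (ρ k) (ρ k') with h | h | h
    · exact absurd (hP'.2.2 k ((hT' k).mp hk).1 h) hP.2.1
    · rw [hρ h]
    · exact absurd (hP.2.2 k' ((hT' k').mp hk').1 h) hP'.2.1

end Combinatorics

/-! ### The connected case -/

section Connected

variable {F : Finset (Fin 4) → Prop} {T : Finset (Fin 4)}

/-- Only the first two places in the order matter: sets containing `k` and `l` and omitting a third
vertex form a chain. -/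
theorem isPartitionable_three (hmono : ∀ A B, A ⊆ B → F A → F B) {k l : Fin 4} (hkl : l ≠ k)
    (hkT : k ∈ T) (hl : T = {k} ∨ l ∈ T)
    (hk : ∀ A B, F A → F B → k ∉ A → k ∉ B → F (A ∩ B))
    (hl' : T = {k} ∨ ∀ A B, F A → F B → k ∈ A → k ∈ B → l ∉ A → l ∉ B → F (A ∩ B)) :
    IsPartitionable F T 3 := by
  classical
  let ρ : Fin 4 → ℕ := fun i => if i = k then 0 else if i = l then 1 else i.val + 2
  have hρk : ρ k = 0 := by simp [ρ]
  have hρl : ρ l = 1 := by simp [ρ, hkl]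
  have hρ : ∀ i, i ≠ k → i ≠ l → ρ i = i.val + 2 := fun i h1 h2 => by simp [ρ, h1, h2]
  refine isPartitionable_of_order hmono ρ (fun i j hij => ?_) ?_
  · simp only [ρ] at hij
    split_ifs at hij with h1 h2 h3 h4 <;> first | omega
  · intro m hm A B hA hB hmA hmB hjA hjB
    by_cases hmk : m = k
    · subst hmk
      exact hk A B hA hB hmA hmB
    have hTk : T ≠ {k} := by
      rintro rfl
      exact hmk (Finset.mem_singleton.mp hm)
    have hlT := hl.resolve_left hTk
    have hkm : ρ k < ρ m := by
      rw [hρk]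
      simp only [ρ, hmk, if_false]
      split_ifs <;> omega
    have hkA := hjA k hkT hkm
    have hkB := hjB k hkT hkm
    by_cases hml : m = l
    · subst hml
      exact hl'.resolve_left hTk A B hA hB hkA hkB hmA hmB
    have hlm : ρ l < ρ m := by rw [hρl, hρ m hmk hml]; omega
    have hlA := hjA l hlT hlm
    have hlB := hjB l hlT hlm
    have : A ⊆ B ∨ B ⊆ A := by
      clear * - hkl hmk hml hmA hmB hkA hkB hlA hlB
      revert A B
      revert k l m
      decide +kernel
    rcases this with h | h
    · rwa [Finset.inter_eq_left.mpr h]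
    · rwa [Finset.inter_eq_right.mpr h]

theorem exists_fourth {k p q : Fin 4} (hpk : p ≠ k) (hqk : q ≠ k) (hpq : p ≠ q) :
    ∃ r, r ≠ k ∧ r ≠ p ∧ r ≠ q ∧ ∀ x, x = k ∨ x = p ∨ x = q ∨ x = r := by
  revert k p q
  decide

theorem subset_pair_of_notMem {A : Finset (Fin 4)} {a b c d : Fin 4} (ha : a ∉ A) (hc : c ∉ A)
    (hall : ∀ x, x = a ∨ x = b ∨ x = c ∨ x = d) : A ⊆ {b, d} := by
  intro x hx
  rw [Finset.mem_insert, Finset.mem_singleton]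
  rcases hall x with h | h | h | h
  · exact absurd (h ▸ hx) ha
  · exact Or.inl h
  · exact absurd (h ▸ hx) hc
  · exact Or.inr h

/-- If the faces with at most two vertices form a connected graph with at least two vertices, then
there is a partition into intervals with maximal elements of cardinality three. -/
theorem isPartitionable_of_connected (hmono : ∀ A B, A ⊆ B → F A → F B)
    (hT : T.Nonempty) (hFT : F T) (h1 : ∀ l, ∃ i, i ≠ l ∧ ¬ F {i})
    (h2 : ∀ (V : Finset (Fin 4)) i j, i ∈ V → j ∉ V → ¬ F {i} → ¬ F {j} →
      ∃ p ∈ V, ∃ q ∉ V, ¬ F {p, q}) : IsPartitionable F T 3 := by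
  classical
  let v : Fin 4 → Bool := ![decide (F {0}), decide (F {1}), decide (F {2}), decide (F {3})]
  let e : Fin 4 → Fin 4 → Bool := ![
    ![decide (F {0}), decide (F {0, 1}), decide (F {0, 2}), decide (F {0, 3})],
    ![decide (F {0, 1}), decide (F {1}), decide (F {1, 2}), decide (F {1, 3})],
    ![decide (F {0, 2}), decide (F {1, 2}), decide (F {2}), decide (F {2, 3})],
    ![decide (F {0, 3}), decide (F {1, 3}), decide (F {2, 3}), decide (F {3})]]
  have hv (i) : v i = true ↔ F {i} := by fin_cases i <;> simp [v]
  have he (i j) : e i j = true ↔ F {i, j} := by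
    fin_cases i <;> fin_cases j <;>
      simp [e, Finset.pair_comm (1 : Fin 4) 0, Finset.pair_comm (2 : Fin 4) 0,
        Finset.pair_comm (3 : Fin 4) 0, Finset.pair_comm (2 : Fin 4) 1,
        Finset.pair_comm (3 : Fin 4) 1, Finset.pair_comm (3 : Fin 4) 2]
  have key : HasGoodOrder v e := hasGoodOrder _ _ _ _ _ _ _ _ _ _
  unfold HasGoodOrder at key
  simp only [hv, he] at key
  obtain ⟨k, hkT, hk, hl⟩ := key (fun i j h => hmono _ _ (by simp) h) h1
    (fun V ⟨i, hi, hi'⟩ ⟨j, hj, hj'⟩ => by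
      obtain ⟨p, hp, q, hq, h⟩ := h2 V i j hi hj hi' hj'
      exact ⟨p, hp, q, hq, h⟩) T hT (fun i j h => h ▸ hFT)
  have hkc : ∀ A B, F A → F B → k ∉ A → k ∉ B → F (A ∩ B) := by
    intro A B hA hB hkA hkB
    by_cases hAB : A ⊆ B
    · rwa [Finset.inter_eq_left.mpr hAB]
    by_cases hBA : B ⊆ A
    · rwa [Finset.inter_eq_right.mpr hBA]
    obtain ⟨p, hpA, hpB⟩ := Finset.not_subset.mp hAB
    obtain ⟨q, hqB, hqA⟩ := Finset.not_subset.mp hBA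
    have hpk : p ≠ k := fun h => hkA (h ▸ hpA)
    have hqk : q ≠ k := fun h => hkB (h ▸ hqB)
    have hpq : p ≠ q := fun h => hqA (h ▸ hpA)
    obtain ⟨r, hrk, hrp, hrq, hall⟩ := exists_fourth hpk hqk hpq
    have hA' : A ⊆ {p, r} := subset_pair_of_notMem hkA hqA hall
    have hB' : B ⊆ {q, r} := subset_pair_of_notMem hkB hpB fun x => by
      have := hall x; tauto
    have hFp := hmono _ _ hA' hA
    have hFq := hmono _ _ hB' hB
    -- If `r` lies in both sets, the intersection is `{r}`. Otherwise one set is a singleton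
    -- disjoint from the pair containing the other, which the choice of `k` excludes.
    by_cases hrA : r ∈ A
    · by_cases hrB : r ∈ B
      · exact hmono _ _ (by simp [hrA, hrB]) ((hk p q r hpk hqk hrk hpq hrp.symm hrq.symm).2 hFp hFq)
      · refine absurd (hmono B {q} (fun x hx => ?_) hB)
          ((hk p q r hpk hqk hrk hpq hrp.symm hrq.symm).1 hFp)
        have := hB' hx
        simp only [Finset.mem_insert, Finset.mem_singleton] at this ⊢
        exact this.resolve_right fun h => hrB (h ▸ hx)
    · refine absurd (hmono A {p} (fun x hx => ?_) hA)
          ((hk q p r hqk hpk hrk hpq.symm hrq.symm hrp.symm).1 hFq)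
      have := hA' hx
      simp only [Finset.mem_insert, Finset.mem_singleton] at this ⊢
      exact this.resolve_right fun h => hrA (h ▸ hx)
  rcases hl with hTk | ⟨l, hlT, hlk, hl⟩
  · obtain ⟨l, hl⟩ := exists_ne k
    exact isPartitionable_three hmono hl hkT (Or.inl hTk) hkc (Or.inl hTk)
  · refine isPartitionable_three hmono hlk hkT (Or.inr hlT) hkc (Or.inr ?_)
    intro A B hA hB hkA hkB hlA hlB
    by_cases hAB : A ⊆ B
    · rwa [Finset.inter_eq_left.mpr hAB]
    by_cases hBA : B ⊆ A
    · rwa [Finset.inter_eq_right.mpr hBA]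
    obtain ⟨p, hpA, hpB⟩ := Finset.not_subset.mp hAB
    obtain ⟨q, hqB, hqA⟩ := Finset.not_subset.mp hBA
    have hpk : p ≠ k := fun h => hpB (h ▸ hkB)
    have hqk : q ≠ k := fun h => hqA (h ▸ hkA)
    have hpl : p ≠ l := fun h => hlA (h ▸ hpA)
    have hql : q ≠ l := fun h => hlB (h ▸ hqB)
    have hpq : p ≠ q := fun h => hqA (h ▸ hpA)
    have hall : ∀ x, x = k ∨ x = p ∨ x = q ∨ x = l := by
      clear * - hpk hqk hpl hql hpq hlk
      revert k l p q
      decide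
    have hA' : A ⊆ {k, p} := subset_pair_of_notMem hlA hqA fun x => by
      have := hall x; tauto
    have hB' : B ⊆ {k, q} := subset_pair_of_notMem hlB hpB fun x => by
      have := hall x; tauto
    exact hmono _ _ (by simp [hkA, hkB])
      (hl p q hpk hpl hqk hql hpq (hmono _ _ hA' hA) (hmono _ _ hB' hB))

/-- All sets belong to `F`, so any order works. -/
theorem isPartitionable_of_empty_mem (hmono : ∀ A B, A ⊆ B → F A → F B) (h0 : F ∅) : IsPartitionable F T 3 := by
  have hF : ∀ A, F A := fun A => hmono _ _ (Finset.empty_subset A) h0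
  exact isPartitionable_of_order hmono Fin.val Fin.val_injective fun _ _ _ _ _ _ _ _ _ _ => hF _

end Connected

/-! ### Transfer to the Stanley depth of `J / I` -/

section Partition

variable {K : Type*} [Field K] {I J : Ideal (MvPolynomial (Fin 4) K)} {T : Finset (Fin 4)}

/-- The differences `J \ I` and `(J + (x_T)) \ (x_T)` contain the same squarefree monomials. -/
theorem IsPartitionable.le_sdepth (hI : IsSqfreeMonomialIdeal I) (hJ : IsSqfreeMonomialIdeal J)
    (h : I = J ⊓ Ideal.span {sqfreeMonomial K T}) {t : ℕ}
    (hP : IsPartitionable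
      (fun B => sqfreeMonomial K B ∈ J ⊔ Ideal.span {sqfreeMonomial K T}) T t) :
    (t : ℕ∞) ≤ sdepth (quotientPiece I J) := by
  have hU := isSqfreeMonomialIdeal_span_singleton (K := K) T
  have hT (B) : sqfreeMonomial K B ∈ Ideal.span {sqfreeMonomial K T} ↔ T ⊆ B := by
    rw [← Set.image_singleton, sqfreeMonomial_mem_span_iff]
    simp
  have hsup (B) : sqfreeMonomial K B ∈ J ⊔ Ideal.span {sqfreeMonomial K T} ↔
      sqfreeMonomial K B ∈ J ∨ T ⊆ B := by
    rw [hJ.sqfreeMonomial_mem_sup_iff hU, hT]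
  have hinf (B) : sqfreeMonomial K B ∈ I ↔ sqfreeMonomial K B ∈ J ∧ T ⊆ B := by
    rw [h, Submodule.mem_inf, hT]
  obtain ⟨D, h1, h2, h3⟩ := hP
  refine IsIntervalPartition.le_sdepth (D := D) ⟨fun P hP => (h1 P hP).1, fun P hP => ?_,
    fun P hP => ?_, fun C hC hCI => ?_, h3⟩ hI hJ fun P hP => (h1 P hP).2.2.2
  · exact ((hsup _).mp (h1 P hP).2.1).resolve_right
      fun h => (h1 P hP).2.2.1 (h.trans (h1 P hP).1)
  · exact fun h => (h1 P hP).2.2.1 ((hinf _).mp h).2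
  · exact h2 C ((hsup C).mpr (Or.inl hC)) fun h => hCI ((hinf C).mpr ⟨hC, h⟩)

end Partition

end StanleyDepth

end

theorem lemma41 {K : Type*} [Field K] (I J : Ideal (MvPolynomial (Fin 4) K))
    (hI : StanleyDepth.IsSqfreeMonomialIdeal I) (hJ : StanleyDepth.IsSqfreeMonomialIdeal J)
    (hI0 : I ≠ ⊥) (hIJ : I < J)
    (hAss : ∀ Q ∈ associatedPrimes (MvPolynomial (Fin 4) K) (StanleyDepth.IdealQuotient I J),
      ringKrullDim (MvPolynomial (Fin 4) K ⧸ Q) = 3) :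
    StanleyDepth.depth (Fin 4) K (StanleyDepth.IdealQuotient I J) ≤
      StanleyDepth.sdepth (StanleyDepth.quotientPiece I J) := by
  open StanleyDepth MvPolynomial in
  obtain ⟨T, hT, hIT, hTX⟩ := exists_eq_inf_span_sqfreeMonomial hI hI0 hIJ hAss
  have hJ' : IsSqfreeMonomialIdeal (J ⊔ Ideal.span {sqfreeMonomial K T}) :=
    hJ.sup (isSqfreeMonomialIdeal_span_singleton T)
  have hone : sqfreeMonomial K (∅ : Finset (Fin 4)) = 1 := Finset.prod_empty
  have hvar (i : Fin 4) : sqfreeMonomial K {i} = X i := Finset.prod_singleton _ _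
  have hmono : ∀ A B : Finset (Fin 4), A ⊆ B →
      sqfreeMonomial K A ∈ J ⊔ Ideal.span {sqfreeMonomial K T} →
      sqfreeMonomial K B ∈ J ⊔ Ideal.span {sqfreeMonomial K T} :=
    fun A B h => sqfreeMonomial_mem_of_subset h
  have hFT : sqfreeMonomial K T ∈ J ⊔ Ideal.span {sqfreeMonomial K T} :=
    Ideal.mem_sup_right (Ideal.mem_span_singleton_self _)
  refine iSup₂_le fun rs hrs => ?_
  obtain ⟨hmem, hreg⟩ := hrs
  have hlen := length_le_three_of_isRegular hI0 hreg
  -- This is the case `J + (x_T) = S`, where the complex has no faces at all, not even `∅`.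
  by_cases h1 : sqfreeMonomial K ∅ ∈ J ⊔ Ideal.span {sqfreeMonomial K T}
  · exact le_trans (Nat.cast_le.mpr hlen)
      ((isPartitionable_of_empty_mem hmono h1).le_sdepth hI hJ hIT)
  match rs, hmem, hreg, hlen with
  | [], _, _, _ => simp
  | [f], _, _, _ =>
    exact (isPartitionable_of_empty h1).le_sdepth hI hJ hIT
  | [f, g], hmem, hreg, _ =>
    obtain ⟨l, hl⟩ : ∃ l, X l ∉ J ⊔ Ideal.span {sqfreeMonomial K T} := by
      by_contra! hall
      refine h1 ?_
      rw [hone]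
      exact one_mem_of_isRegular_pair hIT hTX hreg (hmem f (by simp)) (hmem g (by simp)) hall
    exact (isPartitionable_two hmono hT hFT (l := l) (by rwa [hvar])).le_sdepth hI hJ hIT
  | [f, g, k], hmem, hreg, _ =>
    have hcoh := exists_coboundary_sup hIT hTX hreg (hmem f (by simp)) (hmem g (by simp))
      (hmem k (by simp))
    rw [hone] at h1
    refine (isPartitionable_of_connected hmono hT hFT (fun l => ?_) ?_).le_sdepth hI hJ hIT
    · simpa only [hvar] using exists_X_notMem_of_cohomology hJ' hcoh h1 l
    · intro V i j hi hj hiF hjF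
      rw [hvar] at hiF hjF
      obtain ⟨p, hp, q, hq, hpq⟩ := exists_X_mul_X_notMem_of_cohomology hJ' hcoh hi hj hiF hjF
      refine ⟨p, hp, q, hq, ?_⟩
      have hne : p ≠ q := by rintro rfl; exact hq hp
      have hpair : sqfreeMonomial K {p, q} = X p * X q := Finset.prod_pair hne
      rwa [hpair]
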